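/- Let $d\ge 2$ and let $1<n_1<\dots<n_d$ be integers. Let $\mathcal I\subseteq\prod_{l=1}^d\{0,\dots,n_l-1\}$ be non-empty, let $(p_{\mathbf i})_{\mathbf i\in\mathcal I}$ be a probability vector with all $p_{\mathbf i}>0$, and for $\mathbf i=(i_1,\dots,i_d)\in\mathcal I$ put $S_{\mathbf i}(x_1,\dots,x_d)=\left(\frac{x_1+i_1}{n_1},\dots,\frac{x_d+i_d}{n_d}\right)$. Let $\mu$ be the associated self-affine measure, i.e. the unique Borel probability measure on $\mathbb R^d$ with $\mu=\sum_{\mathbf i\in\mathcal I}p_{\mathbf i}\,\mu\circ S_{\mathbf i}^{-1}$ (it is supported on the Bedford–McMullen sponge, the attractor of $\{S_{\mathbf i}\}_{\mathbf i\in\mathcal I}$). Assume the very strong separation condition: whenever $1\le l\le d$ and $\mathbf i,\mathbf j\in\mathcal I$ satisfy $i_1=j_1,\dots,i_{l-1}=j_{l-1}$ and $i_l\ne j_l$, then $|i_l-j_l|>1$. For $\mathbf i\in\mathcal I$ and $1\le l\le d$ let $$p_l(\mathbf i)=\frac{\sum_{\mathbf j\in\mathcal I:\ j_1=i_1,\dots,j_l=i_l}p_{\mathbf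 j}}{\sum_{\mathbf j\in\mathcal I:\ j_1=i_1,\dots,j_{l-1}=i_{l-1}}p_{\mathbf j}}.$$ The upper regularity dimension of $\mu$ is $$\overline{\dim}_{\mathrm{reg}}\,\mu=\inf\left\{s\ge 0:\ \exists\, C>0\ \ \forall\, 0<r<R\ \ \forall\, x\in\operatorname{supp}\mu,\ \ \frac{\mu(B(x,R))}{\mu(B(x,r))}\le C\left(\frac Rr\right)^s\right\},$$ where $B(x,R)$ is the open Euclidean ball and $\inf\emptyset=+\infty$. Then $$\overline{\dim}_{\mathrm{reg}}\,\mu=\sum_{l=1}^d\max_{\mathbf i\in\mathcal I}\frac{-\log p_l(\mathbf i)}{\log n_l}.$$ -/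

import Mathlib

open MeasureTheory

/-- The upper regularity dimension of a measure on a metric space: the infimum of those `s ≥ 0` for
which `μ(B(x,R)) / μ(B(x,r)) ≤ C (R/r)^s` for some `C > 0` and all `0 < r < R` and all `x` in the
support of `μ`, with the convention `inf ∅ = +∞`. -/
noncomputable def upperRegularityDim {X : Type*} [PseudoMetricSpace X] [MeasurableSpace X]
    (μ : Measure X) : EReal :=
  sInf ((fun s : ℝ => (s : EReal)) '' {s : ℝ | 0 ≤ s ∧ ∃ C : ℝ, 0 < C ∧
    ∀ r R : ℝ, 0 < r → r < R → ∀ x ∈ μ.support,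
      μ (Metric.ball x R) / μ (Metric.ball x r) ≤ ENNReal.ofReal (C * (R / r) ^ s)})

/-- The affine contraction `x ↦ ((x_1 + i_1) / n_1, …, (x_d + i_d) / n_d)` attached to a digit
vector `i`. -/
noncomputable def spongeMap {d : ℕ} (n : Fin d → ℕ) (i : ∀ l, Fin (n l))
    (x : EuclideanSpace ℝ (Fin d)) : EuclideanSpace ℝ (Fin d) :=
  WithLp.toLp 2 fun l => (x l + ((i l : ℕ) : ℝ)) / (n l : ℝ)

theorem measurable_spongeMap {d : ℕ} (n : Fin d → ℕ) (i : ∀ l, Fin (n l)) :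
    Measurable (spongeMap n i) := by
  unfold spongeMap
  have h : Continuous fun x : EuclideanSpace ℝ (Fin d) =>
      WithLp.toLp 2 fun l => (x l + ((i l : ℕ) : ℝ)) / (n l : ℝ) := by
    fun_prop
  exact h.measurable

/-- `p` is a probability vector on the finite set `I`, with all weights strictly positive. -/
structure IsPosProbVector {α : Type*} (I : Finset α) (p : α → ℝ) : Prop where
  pos : ∀ i ∈ I, 0 < p i
  sum_eq_one : ∑ i ∈ I, p i = 1

/-- `μ` is the self-affine measure of the iterated function system `(spongeMap n i)_{i ∈ I}` with
weights `p`: the Borel probability measure with `μ = ∑ p_i μ ∘ S_i⁻¹`. -/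
structure IsSelfAffineMeasure {d : ℕ} (n : Fin d → ℕ) (I : Finset (∀ l, Fin (n l)))
    (p : (∀ l, Fin (n l)) → ℝ) (μ : Measure (EuclideanSpace ℝ (Fin d))) : Prop where
  isProbabilityMeasure : IsProbabilityMeasure μ
  invariant : μ = ∑ i ∈ I, ENNReal.ofReal (p i) • μ.map (spongeMap n i)

/-- The very strong separation condition: if two digit vectors in `I` agree before the `l`-th
coordinate and differ in the `l`-th coordinate, then their `l`-th digits differ by more than one. -/
def VeryStrongSeparation {d : ℕ} (n : Fin d → ℕ) (I : Finset (∀ l, Fin (n l))) : Prop :=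
  ∀ l : Fin d, ∀ i ∈ I, ∀ j ∈ I, (∀ m, m < l → i m = j m) → i l ≠ j l →
    1 < |((i l : ℕ) : ℤ) - ((j l : ℕ) : ℤ)|

/-- The conditional probability `p_l(i) = p(i_l | i_1, …, i_{l-1})` that the `l`-th digit agrees
with that of `i`, given that the earlier ones do. -/
noncomputable def condDigitProb {d : ℕ} (n : Fin d → ℕ) (I : Finset (∀ l, Fin (n l)))
    (p : (∀ l, Fin (n l)) → ℝ) (l : Fin d) (i : ∀ l, Fin (n l)) : ℝ :=
  (∑ j ∈ I with ∀ m, m ≤ l → j m = i m, p j) / ∑ j ∈ I with ∀ m, m < l → j m = i m, p j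

/-! Balls are compared with approximate cubes, which fix the first `k l` digits in direction `l`.
Since the `n l` increase, the levels belonging to a scale decrease in `l`, so the directions
constrained at each digit position form an initial segment. The conditional probabilities then
telescope, and the measure of a cube is the product of all its conditional digit probabilities
(`measureReal_approxCube`). Very strong separation keeps a small enough ball centred in a cube from
charging anything outside it (`measure_ball_le_approxCube`); conversely, a cube with small enough
sides lies in a ball about any of its points (`approxCube_subset_ball`).

Passing from scale `R` to `r` adds about `log (R/r) / log (n l)` digits in direction `l`, each
costing a factor at least `(n l) ^ (-sideExponent)`. This gives the upper bound
(`measureReal_ball_le`). For sharpness, fix the ratio `R/r = exp T` and let `R` be tiny: the ranges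
of added digit positions for different directions become disjoint, because the `log (n l)` are
distinct. Hence every direction can use its own worst digit vector throughout its range, and all the
maxima are attained at once (`exists_le_measureReal_ball`). -/

/-! ### Digit intervals on the line. -/

/-- The `n`-adic interval of level `k` with digits `a 0, …, a (k - 1)`. -/
def digitInterval (n : ℕ) : ℕ → (ℕ → ℕ) → Set ℝ
  | 0, _ => Set.Icc 0 1
  | k + 1, a => {x | n * x - a 0 ∈ digitInterval n k fun t => a (t + 1)}

theorem digitInterval_subset_Icc {n : ℕ} :
    ∀ (k : ℕ) (a : ℕ → ℕ), (∀ t, a t < n) → digitInterval n k a ⊆ Set.Icc 0 1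
  | 0, _, _ => subset_rfl
  | k + 1, a, ha => fun x hx => by
    have h := digitInterval_subset_Icc k _ (fun t => ha (t + 1)) hx
    have h0 : (0 : ℝ) < n := by exact_mod_cast (Nat.zero_le _).trans_lt (ha 0)
    have h1 : (a 0 : ℝ) + 1 ≤ n := by exact_mod_cast ha 0
    have h2 : (0 : ℝ) ≤ a 0 := by positivity
    obtain ⟨h3, h4⟩ := h
    constructor
    · by_contra! hc
      nlinarith [mul_neg_of_pos_of_neg h0 hc]
    · by_contra! hc
      nlinarith [mul_pos h0 (sub_pos.2 hc)]

theorem digitInterval_succ_subset {n : ℕ} :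
    ∀ (k : ℕ) (a : ℕ → ℕ), (∀ t, a t < n) → digitInterval n (k + 1) a ⊆ digitInterval n k a
  | 0, a, ha => digitInterval_subset_Icc 1 a ha
  | k + 1, _, ha => fun _ hx => digitInterval_succ_subset k _ (fun t => ha (t + 1)) hx

theorem digitInterval_anti {n : ℕ} {a : ℕ → ℕ} (ha : ∀ t, a t < n) :
    Antitone fun k => digitInterval n k a :=
  antitone_nat_of_succ_le fun k => digitInterval_succ_subset k a ha

theorem digitInterval_congr {n : ℕ} : ∀ (k : ℕ) (a b : ℕ → ℕ), (∀ t < k, a t = b t) →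
    digitInterval n k a = digitInterval n k b
  | 0, _, _, _ => rfl
  | k + 1, a, b, h => by
    have h1 := digitInterval_congr (n := n) k (fun t => a (t + 1)) (fun t => b (t + 1))
      fun t ht => h _ (by omega)
    simp only [digitInterval, h 0 (by omega), h1]

theorem isClosed_digitInterval {n : ℕ} : ∀ (k : ℕ) (a : ℕ → ℕ), IsClosed (digitInterval n k a)
  | 0, _ => isClosed_Icc
  | k + 1, a => (isClosed_digitInterval k fun t => a (t + 1)).preimage
      (by fun_prop : Continuous fun x : ℝ => n * x - a 0)

theorem pow_mul_abs_sub_le_one {n : ℕ} : ∀ (k : ℕ) (a : ℕ → ℕ) (x y : ℝ),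
    x ∈ digitInterval n k a → y ∈ digitInterval n k a → (n : ℝ) ^ k * |x - y| ≤ 1
  | 0, _, x, y, hx, hy => by
    rw [pow_zero, one_mul, abs_le]
    constructor <;> linarith [hx.1, hx.2, hy.1, hy.2]
  | k + 1, a, x, y, hx, hy => by
    have h := pow_mul_abs_sub_le_one k _ _ _ hx hy
    have h1 : (n * x - a 0) - (n * y - a 0) = n * (x - y) := by ring
    rwa [h1, abs_mul, Nat.abs_cast, ← mul_assoc, ← pow_succ] at h

/-- Two points whose `n`-adic digits first differ at position `t`, and do so by more than one, are
at distance at least `n⁻⁽ᵗ⁺¹⁾`. -/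
theorem one_le_pow_mul_abs_sub {n : ℕ} : ∀ (t k : ℕ) (a b : ℕ → ℕ) (x y : ℝ),
    (∀ m, a m < n) → (∀ m, b m < n) → t < k → (∀ m < t, a m = b m) →
    1 < |((a t : ℕ) : ℤ) - ((b t : ℕ) : ℤ)| →
    x ∈ digitInterval n k a → y ∈ digitInterval n k b → 1 ≤ (n : ℝ) ^ (t + 1) * |x - y|
  | t, 0, _, _, _, _, _, _, h, _, _, _, _ => absurd h (Nat.not_lt_zero t)
  | 0, k + 1, a, b, x, y, ha, hb, _, _, hd, hx, hy => by
    have hx' := digitInterval_subset_Icc k _ (fun t => ha (t + 1)) hx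
    have hy' := digitInterval_subset_Icc k _ (fun t => hb (t + 1)) hy
    have hd' : (2 : ℝ) ≤ |(a 0 : ℝ) - b 0| := by
      have : (2 : ℤ) ≤ |((a 0 : ℕ) : ℤ) - ((b 0 : ℕ) : ℤ)| := hd
      exact_mod_cast this
    have h1 : (n : ℝ) ^ (0 + 1) * |x - y| = |n * x - n * y| := by
      rw [zero_add, pow_one, ← mul_sub, abs_mul, Nat.abs_cast]
    rw [h1]
    rcases le_abs.1 hd' with h | h
    · exact le_abs.2 (Or.inl (by linarith [hx'.1, hx'.2, hy'.1, hy'.2]))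
    · exact le_abs.2 (Or.inr (by linarith [hx'.1, hx'.2, hy'.1, hy'.2]))
  | t + 1, k + 1, a, b, x, y, ha, hb, ht, hab, hd, hx, hy => by
    have h := one_le_pow_mul_abs_sub t k _ _ _ _ (fun m => ha (m + 1)) (fun m => hb (m + 1))
      (by omega) (fun m hm => hab (m + 1) (by omega)) hd hx hy
    have h1 : (n * x - a 0) - (n * y - b 0) = n * (x - y) := by
      rw [hab 0 (by omega)]; ring
    rwa [h1, abs_mul, Nat.abs_cast, ← mul_assoc, ← pow_succ] at h

/-! ### Conditional digit probabilities. -/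

/-- The probability of agreeing with `i` in the first `m` digits is a product of conditional
probabilities. -/
theorem sum_filter_eq_prod_condDigitProb {d : ℕ} {n : Fin d → ℕ} {I : Finset (∀ l, Fin (n l))}
    {p : (∀ l, Fin (n l)) → ℝ} (hp : IsPosProbVector I p) {i : ∀ l, Fin (n l)} (hi : i ∈ I) :
    ∀ m ≤ d, ∑ j ∈ I with ∀ l : Fin d, l.val < m → j l = i l, p j =
      ∏ l : Fin d with l.val < m, condDigitProb n I p l i
  | 0, _ => by simp [hp.sum_eq_one]
  | m + 1, hm => by
    have ih := sum_filter_eq_prod_condDigitProb hp hi m (by omega)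
    set l₀ : Fin d := ⟨m, hm⟩ with hl₀
    have h1 : (Finset.univ.filter fun l : Fin d => l.val < m + 1) =
        insert l₀ (Finset.univ.filter fun l : Fin d => l.val < m) := by
      ext l
      simp only [Finset.mem_filter, Finset.mem_univ, true_and, Finset.mem_insert, Fin.ext_iff, hl₀]
      omega
    rw [h1, Finset.prod_insert (by simp [hl₀]), ← ih, condDigitProb]
    have h2 : ∑ j ∈ I with ∀ l, l ≤ l₀ → j l = i l, p j =
        ∑ j ∈ I with ∀ l : Fin d, l.val < m + 1 → j l = i l, p j := by
      simp only [Fin.le_def, hl₀, Nat.lt_succ_iff]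
    have h3 : ∑ j ∈ I with ∀ l, l < l₀ → j l = i l, p j =
        ∑ j ∈ I with ∀ l : Fin d, l.val < m → j l = i l, p j := by
      simp only [Fin.lt_def, hl₀]
    have h4 : 0 < ∑ j ∈ I with ∀ l : Fin d, l.val < m → j l = i l, p j :=
      Finset.sum_pos (fun j hj => hp.pos j (Finset.mem_filter.1 hj).1)
        ⟨i, Finset.mem_filter.2 ⟨hi, fun _ _ => rfl⟩⟩
    rw [h2, h3, div_mul_cancel₀ _ h4.ne']

theorem condDigitProb_pos {d : ℕ} {n : Fin d → ℕ} {I : Finset (∀ l, Fin (n l))}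
    {p : (∀ l, Fin (n l)) → ℝ} (hp : IsPosProbVector I p) {i : ∀ l, Fin (n l)} (hi : i ∈ I)
    (l : Fin d) : 0 < condDigitProb n I p l i :=
  div_pos
    (Finset.sum_pos (fun j hj => hp.pos j (Finset.mem_filter.1 hj).1)
      ⟨i, Finset.mem_filter.2 ⟨hi, fun _ _ => rfl⟩⟩)
    (Finset.sum_pos (fun j hj => hp.pos j (Finset.mem_filter.1 hj).1)
      ⟨i, Finset.mem_filter.2 ⟨hi, fun _ _ => rfl⟩⟩)

theorem condDigitProb_le_one {d : ℕ} {n : Fin d → ℕ} {I : Finset (∀ l, Fin (n l))}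
    {p : (∀ l, Fin (n l)) → ℝ} (hp : IsPosProbVector I p) (i : ∀ l, Fin (n l))
    (l : Fin d) : condDigitProb n I p l i ≤ 1 := by
  refine div_le_one_of_le₀ (Finset.sum_le_sum_of_subset_of_nonneg ?_ ?_)
    (Finset.sum_nonneg fun j hj => (hp.pos j (Finset.mem_filter.1 hj).1).le)
  · exact Finset.monotone_filter_right _ fun j _ h m hm => h m hm.le
  · exact fun j hj _ => (hp.pos j (Finset.mem_filter.1 hj).1).le

/-! ### Consequences of invariance: the unit cube, prefractals and the support. -/

theorem IsSelfAffineMeasure.apply_eq_sum {d : ℕ} {n : Fin d → ℕ} {I : Finset (∀ l, Fin (n l))}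
    {p : (∀ l, Fin (n l)) → ℝ} {μ : Measure (EuclideanSpace ℝ (Fin d))}
    (hμ : IsSelfAffineMeasure n I p μ) {A : Set (EuclideanSpace ℝ (Fin d))}
    (hA : MeasurableSet A) :
    μ A = ∑ j ∈ I, ENNReal.ofReal (p j) * μ (spongeMap n j ⁻¹' A) := by
  conv_lhs => rw [hμ.invariant]
  rw [Measure.finsetSum_apply]
  refine Finset.sum_congr rfl fun j _ => ?_
  rw [Measure.smul_apply, Measure.map_apply (measurable_spongeMap n j) hA, smul_eq_mul]

theorem IsSelfAffineMeasure.le_of_subset_preimage {d : ℕ} {n : Fin d → ℕ}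
    {I : Finset (∀ l, Fin (n l))} {p : (∀ l, Fin (n l)) → ℝ} (hp : IsPosProbVector I p)
    {μ : Measure (EuclideanSpace ℝ (Fin d))} (hμ : IsSelfAffineMeasure n I p μ)
    {A B : Set (EuclideanSpace ℝ (Fin d))} (hA : MeasurableSet A)
    (hAB : ∀ j ∈ I, B ⊆ spongeMap n j ⁻¹' A) : μ B ≤ μ A := by
  rw [hμ.apply_eq_sum hA]
  calc μ B = ∑ j ∈ I, ENNReal.ofReal (p j) * μ B := by
        rw [← Finset.sum_mul, ← ENNReal.ofReal_sum_of_nonneg fun j hj => (hp.pos j hj).le,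
          hp.sum_eq_one, ENNReal.ofReal_one, one_mul]
    _ ≤ _ := Finset.sum_le_sum fun j hj => mul_le_mul_right (measure_mono (hAB j hj)) _

/-- A self-affine measure of digit contractions gives full mass to the unit cube. -/
theorem IsSelfAffineMeasure.ae_mem_Icc {d : ℕ} {n : Fin d → ℕ} (hn1 : ∀ l, 1 < n l)
    {I : Finset (∀ l, Fin (n l))} {p : (∀ l, Fin (n l)) → ℝ} (hp : IsPosProbVector I p)
    {μ : Measure (EuclideanSpace ℝ (Fin d))} (hμ : IsSelfAffineMeasure n I p μ) :
    ∀ᵐ x ∂μ, ∀ l, x l ∈ Set.Icc (0 : ℝ) 1 := by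
  have := hμ.isProbabilityMeasure
  rw [ae_all_iff]
  intro l
  let A : ℝ → Set (EuclideanSpace ℝ (Fin d)) := fun t => {x | x l ∈ Set.Icc (-t) (1 + t)}
  have hAc : ∀ t, IsClosed (A t) := fun t => isClosed_Icc.preimage
    (by fun_prop : Continuous fun x : EuclideanSpace ℝ (Fin d) => x l)
  -- Each map contracts by at least 2, so it sends the slab of margin `2 * t` into that of margin
  -- `t`. Iterating, slabs that exhaust the space have no more mass than `A t`, which is therefore
  -- full for every `t > 0`.
  have hstep : ∀ t, 0 ≤ t → μ (A (2 * t)) ≤ μ (A t) := fun t ht => by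
    refine hμ.le_of_subset_preimage hp (hAc t).measurableSet fun j _ x hx => ?_
    have h2 : (2 : ℝ) ≤ n l := by exact_mod_cast hn1 l
    have hj : ((j l : ℕ) : ℝ) + 1 ≤ n l := by exact_mod_cast (j l).2
    have hj0 : (0 : ℝ) ≤ ((j l : ℕ) : ℝ) := by positivity
    obtain ⟨h3, h4⟩ := hx
    have h5 : 2 * t ≤ t * n l := by nlinarith
    change (x l + ((j l : ℕ) : ℝ)) / (n l : ℝ) ∈ Set.Icc (-t) (1 + t)
    rw [Set.mem_Icc, le_div_iff₀ (by linarith), div_le_iff₀ (by linarith)]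
    constructor <;> linarith
  have hpow : ∀ t, 0 ≤ t → ∀ k : ℕ, μ (A (2 ^ k * t)) ≤ μ (A t) := fun t ht k => by
    induction k with
    | zero => simp
    | succ k ih =>
      refine le_trans ?_ ih
      rw [pow_succ', mul_assoc]
      exact hstep _ (by positivity)
  have hmono : ∀ t, 0 < t → Monotone fun k : ℕ => A (2 ^ k * t) := fun t ht k k' hk x hx => by
    have : (2 : ℝ) ^ k * t ≤ 2 ^ k' * t := by gcongr; norm_num
    exact ⟨by linarith [hx.1], by linarith [hx.2]⟩
  have hfull : ∀ t, 0 < t → ∀ᵐ x ∂μ, x ∈ A t := fun t ht => by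
    refine (mem_ae_iff_prob_eq_one (hAc t).measurableSet).2 (le_antisymm prob_le_one ?_)
    have hU : ⋃ k : ℕ, A (2 ^ k * t) = Set.univ := by
      refine Set.eq_univ_of_forall fun x => Set.mem_iUnion.2 ?_
      obtain ⟨k, hk⟩ := pow_unbounded_of_one_lt (|x l| / t) one_lt_two
      have h := abs_le.1 ((div_lt_iff₀ ht).1 hk).le
      exact ⟨k, h.1, by linarith [h.2]⟩
    have h := tendsto_measure_iUnion_atTop (μ := μ) (hmono t ht)
    rw [hU, measure_univ] at h
    exact le_of_tendsto' h (hpow t ht.le)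
  have h := ae_all_iff.2 fun m : ℕ => hfull (1 / ((m : ℝ) + 1)) (by positivity)
  filter_upwards [h] with x hx
  have hlim : Filter.Tendsto (fun m : ℕ => 1 / ((m : ℝ) + 1)) Filter.atTop (nhds 0) :=
    tendsto_one_div_add_atTop_nhds_zero_nat
  constructor
  · have := le_of_tendsto' hlim.neg fun m => (hx m).1
    simpa using this
  · have := ge_of_tendsto' (hlim.const_add 1) fun m => (hx m).2
    simpa using this

/-- The level-`k` prefractal of the digit contractions. -/
def prefractal {d : ℕ} (n : Fin d → ℕ) (I : Finset (∀ l, Fin (n l))) :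
    ℕ → Set (EuclideanSpace ℝ (Fin d))
  | 0 => {x | ∀ l, x l ∈ Set.Icc (0 : ℝ) 1}
  | k + 1 => ⋃ j ∈ I, {x | WithLp.toLp 2 (fun l => n l * x l - (j l : ℕ)) ∈ prefractal n I k}

theorem isClosed_unitCube {d : ℕ} :
    IsClosed {x : EuclideanSpace ℝ (Fin d) | ∀ l, x l ∈ Set.Icc (0 : ℝ) 1} := by
  simp only [Set.ofPred_forall]
  exact isClosed_iInter fun l => isClosed_Icc.preimage
    (by fun_prop : Continuous fun x : EuclideanSpace ℝ (Fin d) => x l)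

theorem isClosed_prefractal {d : ℕ} {n : Fin d → ℕ} {I : Finset (∀ l, Fin (n l))} :
    ∀ k, IsClosed (prefractal n I k)
  | 0 => isClosed_unitCube
  | k + 1 => isClosed_biUnion_finset fun j _ => (isClosed_prefractal k).preimage
      (by fun_prop : Continuous fun x : EuclideanSpace ℝ (Fin d) =>
        WithLp.toLp 2 fun l => (n l : ℝ) * x l - (j l : ℕ))

theorem exists_digits_of_mem_prefractal {d : ℕ} {n : Fin d → ℕ} {I : Finset (∀ l, Fin (n l))}
    (hI : I.Nonempty) : ∀ (k : ℕ) (x : EuclideanSpace ℝ (Fin d)), x ∈ prefractal n I k →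
      ∃ i : ℕ → ∀ l, Fin (n l), (∀ t, i t ∈ I) ∧
        ∀ l, x l ∈ digitInterval (n l) k fun t => i t l
  | 0, _, hx => ⟨fun _ => hI.choose, fun _ => hI.choose_spec, hx⟩
  | k + 1, x, hx => by
    simp only [prefractal, Set.mem_iUnion, exists_prop] at hx
    obtain ⟨j, hj, hx⟩ := hx
    obtain ⟨i, hi, hxi⟩ := exists_digits_of_mem_prefractal hI k _ hx
    refine ⟨fun | 0 => j | t + 1 => i t, ?_, fun l => hxi l⟩
    rintro (_ | t)
    exacts [hj, hi t]

theorem IsSelfAffineMeasure.measure_prefractal {d : ℕ} {n : Fin d → ℕ} (hn1 : ∀ l, 1 < n l)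
    {I : Finset (∀ l, Fin (n l))} {p : (∀ l, Fin (n l)) → ℝ} (hp : IsPosProbVector I p)
    {μ : Measure (EuclideanSpace ℝ (Fin d))} (hμ : IsSelfAffineMeasure n I p μ) :
    ∀ k, ∀ᵐ x ∂μ, x ∈ prefractal n I k
  | 0 => hμ.ae_mem_Icc hn1 hp
  | k + 1 => by
    have := hμ.isProbabilityMeasure
    have ih := hμ.measure_prefractal hn1 hp k
    have hle : μ (prefractal n I k) ≤ μ (prefractal n I (k + 1)) := by
      refine hμ.le_of_subset_preimage hp (isClosed_prefractal _).measurableSet fun j hj x hx => ?_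
      simp only [prefractal, Set.mem_preimage, Set.mem_iUnion, exists_prop]
      refine ⟨j, hj, ?_⟩
      have hxj : WithLp.toLp 2 (fun l => (n l : ℝ) * spongeMap n j x l - (j l : ℕ)) = x := by
        ext l
        have : (n l : ℝ) ≠ 0 := by exact_mod_cast (zero_lt_one.trans (hn1 l)).ne'
        simp only [spongeMap]
        field_simp
        ring
      change WithLp.toLp 2 (fun l => (n l : ℝ) * spongeMap n j x l - (j l : ℕ)) ∈
        prefractal n I k
      rwa [hxj]
    refine (mem_ae_iff_prob_eq_one (isClosed_prefractal _).measurableSet).2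
      (le_antisymm prob_le_one ?_)
    rwa [(mem_ae_iff_prob_eq_one (isClosed_prefractal _).measurableSet).1 ih] at hle

/-- The prefractal is closed and has full measure, so it contains the support. -/
theorem IsSelfAffineMeasure.exists_digits {d : ℕ} {n : Fin d → ℕ} (hn1 : ∀ l, 1 < n l)
    {I : Finset (∀ l, Fin (n l))} (hI : I.Nonempty) {p : (∀ l, Fin (n l)) → ℝ}
    (hp : IsPosProbVector I p) {μ : Measure (EuclideanSpace ℝ (Fin d))}
    (hμ : IsSelfAffineMeasure n I p μ) {x : EuclideanSpace ℝ (Fin d)} (hx : x ∈ μ.support)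
    (k : ℕ) : ∃ i : ℕ → ∀ l, Fin (n l), (∀ t, i t ∈ I) ∧
      ∀ l, x l ∈ digitInterval (n l) k fun t => i t l :=
  exists_digits_of_mem_prefractal hI k x
    (Measure.support_subset_of_isClosed (isClosed_prefractal k) (hμ.measure_prefractal hn1 hp k) hx)

/-! ### Approximate cubes and their measure. -/

/-- The approximate cube with side `(n l)^(-k l)` in direction `l` and digits `i`. -/
def approxCube {d : ℕ} (n : Fin d → ℕ) (k : Fin d → ℕ) (i : ℕ → ∀ l, Fin (n l)) :
    Set (EuclideanSpace ℝ (Fin d)) :=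
  {x | ∀ l, x l ∈ digitInterval (n l) (k l) fun t => i t l}

theorem isClosed_approxCube {d : ℕ} {n : Fin d → ℕ} (k : Fin d → ℕ) (i : ℕ → ∀ l, Fin (n l)) :
    IsClosed (approxCube n k i) := by
  simp only [approxCube, Set.ofPred_forall]
  exact isClosed_iInter fun l => (isClosed_digitInterval _ _).preimage
    (by fun_prop : Continuous fun x : EuclideanSpace ℝ (Fin d) => x l)

theorem approxCube_subset {d : ℕ} {n : Fin d → ℕ} {k k' : Fin d → ℕ} (h : k ≤ k')
    (i : ℕ → ∀ l, Fin (n l)) : approxCube n k' i ⊆ approxCube n k i :=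
  fun _ hx l => digitInterval_anti (fun t => (i t l).2) (h l) (hx l)

theorem prod_prod_range_eq {d : ℕ} {α : Type*} (f : Fin d → α → ℝ) (k : Fin d → ℕ) (i : ℕ → α) :
    ∏ l, ∏ t ∈ Finset.range (k l), f l (i t) = (∏ l with k l ≠ 0, f l (i 0)) *
      ∏ l, ∏ t ∈ Finset.range (k l - 1), f l (i (t + 1)) := by
  rw [Finset.prod_filter, ← Finset.prod_mul_distrib]
  refine Finset.prod_congr rfl fun l _ => ?_
  rcases hk : k l with _ | m
  · simp
  · simp [Finset.prod_range_succ', mul_comm]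

/-- This makes the condition on the first digit vector a prefix event, to which the telescoping of
`sum_filter_eq_prod_condDigitProb` applies. -/
theorem exists_ne_zero_iff_lt {d : ℕ} {k : Fin d → ℕ} (hk : Antitone k) :
    ∃ m ≤ d, ∀ l, k l ≠ 0 ↔ l.val < m := by
  classical
  have hex : ∃ m, ∀ l : Fin d, m ≤ l.val → k l = 0 := ⟨d, fun l hl => absurd l.2 hl.not_gt⟩
  refine ⟨Nat.find hex, Nat.find_min' hex fun l hl => absurd l.2 hl.not_gt, fun l => ⟨?_, ?_⟩⟩
  · intro h
    by_contra! hc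
    exact h (Nat.find_spec hex l hc)
  · intro h h0
    refine Nat.find_min hex h fun l' hl' => Nat.le_zero.1 ?_
    exact h0 ▸ hk (Fin.le_def.2 hl')

/-- Invariance peels off one digit vector: the maps whose digits match `i 0` in the constrained
directions contribute the cube with all levels lowered by one and digits shifted, and the others
contribute nothing, by separation. Their weights sum to a product of conditional probabilities. -/
theorem IsSelfAffineMeasure.measureReal_approxCube {d : ℕ} {n : Fin d → ℕ} (hn1 : ∀ l, 1 < n l)
    {I : Finset (∀ l, Fin (n l))} (hsep : VeryStrongSeparation n I)
    {p : (∀ l, Fin (n l)) → ℝ} (hp : IsPosProbVector I p)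
    {μ : Measure (EuclideanSpace ℝ (Fin d))} (hμ : IsSelfAffineMeasure n I p μ) :
    ∀ (N : ℕ) (k : Fin d → ℕ) (i : ℕ → ∀ l, Fin (n l)), Antitone k → (∀ l, k l ≤ N) →
      (∀ t, i t ∈ I) → μ.real (approxCube n k i) =
        ∏ l, ∏ t ∈ Finset.range (k l), condDigitProb n I p l (i t)
  | 0, k, i, _, hN, _ => by
    have := hμ.isProbabilityMeasure
    have hk : ∀ l, k l = 0 := fun l => Nat.le_zero.1 (hN l)
    have h : ∀ᵐ x ∂μ, x ∈ approxCube n k i := by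
      filter_upwards [hμ.ae_mem_Icc hn1 hp] with x hx l
      rw [hk l]
      exact hx l
    simp only [hk, Finset.range_zero, Finset.prod_empty, Finset.prod_const_one]
    rw [measureReal_def, (mem_ae_iff_prob_eq_one (isClosed_approxCube k i).measurableSet).1 h, ENNReal.toReal_one]
  | N + 1, k, i, hka, hN, hi => by
    have := hμ.isProbabilityMeasure
    have ih := hμ.measureReal_approxCube hn1 hsep hp N (fun l => k l - 1) (fun t => i (t + 1))
      (fun l l' h => Nat.sub_le_sub_right (hka h) 1) (fun l => by have := hN l; omega)
      fun t => hi _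
    obtain ⟨m, hmd, hm⟩ := exists_ne_zero_iff_lt hka
    rw [prod_prod_range_eq, ← ih]
    simp only [hm]
    rw [← sum_filter_eq_prod_condDigitProb hp (hi 0) m hmd, Finset.sum_mul, Finset.sum_filter,
      measureReal_def, hμ.apply_eq_sum (isClosed_approxCube k i).measurableSet,
      ENNReal.toReal_sum fun j _ => ENNReal.mul_ne_top ENNReal.ofReal_ne_top (measure_ne_top _ _)]
    refine Finset.sum_congr rfl fun j hj => ?_
    have hmem : ∀ x l, k l ≠ 0 → (spongeMap n j x l ∈ digitInterval (n l) (k l) (fun t => i t l) ↔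
        x l + ((j l : ℕ) : ℝ) - (i 0 l : ℕ) ∈
          digitInterval (n l) (k l - 1) fun t => i (t + 1) l) := by
      intro x l hl
      obtain ⟨m, hm⟩ := Nat.exists_eq_succ_of_ne_zero hl
      have hn0 : (n l : ℝ) ≠ 0 := by exact_mod_cast (zero_lt_one.trans (hn1 l)).ne'
      rw [hm]
      change (n l : ℝ) * ((x l + ((j l : ℕ) : ℝ)) / (n l : ℝ)) - (i 0 l : ℕ) ∈
        digitInterval (n l) m (fun t => i (t + 1) l) ↔ _
      rw [mul_div_cancel₀ _ hn0]
      rfl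
    split_ifs with hji
    · rw [ENNReal.toReal_mul, ENNReal.toReal_ofReal (hp.pos j hj).le, measureReal_def]
      congr 2
      refine measure_congr (Filter.eventuallyEq_set.2 ?_)
      filter_upwards [hμ.ae_mem_Icc hn1 hp] with x hx
      refine forall_congr' fun l => ?_
      -- The two sets agree only almost everywhere: in an unconstrained direction both conditions
      -- hold merely because `x` lies in the unit cube.
      by_cases hl : k l = 0
      · have h0 : (0 : ℝ) < n l := by exact_mod_cast zero_lt_one.trans (hn1 l)
        have hj1 : ((j l : ℕ) : ℝ) + 1 ≤ n l := by exact_mod_cast (j l).2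
        have hj0 : (0 : ℝ) ≤ ((j l : ℕ) : ℝ) := by positivity
        change spongeMap n j x l ∈ digitInterval (n l) (k l) _ ↔
          x l ∈ digitInterval (n l) (k l - 1) _
        rw [hl]
        refine iff_of_true ?_ (hx l)
        exact ⟨div_nonneg (by linarith [(hx l).1]) h0.le,
          (div_le_one h0).2 (by linarith [(hx l).2])⟩
      · rw [hmem x l hl, hji l ((hm l).1 hl), add_sub_cancel_right]
    · have h0 : μ (spongeMap n j ⁻¹' approxCube n k i) = 0 := by
        push Not at hji
        -- At the first mismatched direction separation forces a digit gap of at least 2, whereas `x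
        -- l` and its translate by this gap would both have to lie in `[0, 1]`.
        obtain ⟨l, ⟨hlm, hne⟩, hmin⟩ := exists_minimal_of_wellFoundedLT
          (fun l : Fin d => l.val < m ∧ j l ≠ i 0 l) hji
        have hagree : ∀ l', l' < l → j l' = i 0 l' := fun l' hl' => by
          by_contra hc
          exact absurd (hmin ⟨(Fin.lt_def.1 hl').trans hlm, hc⟩ hl'.le) hl'.not_ge
        have hd : (2 : ℝ) ≤ |((j l : ℕ) : ℝ) - (i 0 l : ℕ)| := by
          have : (2 : ℤ) ≤ |((j l : ℕ) : ℤ) - ((i 0 l : ℕ) : ℤ)| := hsep l j hj _ (hi 0) hagree hne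
          exact_mod_cast this
        have hae : ∀ᵐ x ∂μ, x ∉ spongeMap n j ⁻¹' approxCube n k i := by
          filter_upwards [hμ.ae_mem_Icc hn1 hp] with x hx hxj
          have h1 := digitInterval_subset_Icc _ _ (fun t => (i (t + 1) l).2)
            ((hmem x l ((hm l).2 hlm)).1 (hxj l))
          have h2 := hx l
          rcases le_abs.1 hd with h | h <;> linarith [h1.1, h1.2, h2.1, h2.2]
        exact measure_eq_zero_iff_ae_notMem.2 hae
      rw [h0, mul_zero, ENNReal.toReal_zero]

/-- Under very strong separation, a small ball around a point of an approximate cube carries no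
mass outside this cube. -/
theorem IsSelfAffineMeasure.measure_ball_le_approxCube {d : ℕ} {n : Fin d → ℕ}
    (hn1 : ∀ l, 1 < n l) {I : Finset (∀ l, Fin (n l))} (hI : I.Nonempty)
    (hsep : VeryStrongSeparation n I) {p : (∀ l, Fin (n l)) → ℝ} (hp : IsPosProbVector I p)
    {μ : Measure (EuclideanSpace ℝ (Fin d))} (hμ : IsSelfAffineMeasure n I p μ)
    {k : Fin d → ℕ} (hk : Antitone k) {i : ℕ → ∀ l, Fin (n l)} (hi : ∀ t, i t ∈ I)
    {x : EuclideanSpace ℝ (Fin d)} (hx : x ∈ approxCube n k i) {r : ℝ} (hr : 0 < r)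
    (hkr : ∀ l, k l ≠ 0 → (n l : ℝ) ^ k l * r ≤ 1) :
    μ (Metric.ball x r) ≤ μ (approxCube n k i) := by
  refine measure_mono_ae ?_
  filter_upwards [hμ.measure_prefractal hn1 hp (Finset.univ.sup k)] with y hy hyr
  obtain ⟨j, hj, hyj⟩ := exists_digits_of_mem_prefractal hI _ y hy
  have hyk : ∀ l, y l ∈ digitInterval (n l) (k l) fun t => j t l := fun l =>
    digitInterval_anti (fun t => (j t l).2) (Finset.le_sup (Finset.mem_univ l)) (hyj l)
  have hxy : ∀ l, |x l - y l| < r := fun l => by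
    refine lt_of_le_of_lt ?_ (Metric.mem_ball'.1 hyr)
    rw [dist_eq_norm]
    exact PiLp.norm_apply_le (x - y) l
  -- Induction on the position `t`, then the least bad direction `l`: earlier directions are
  -- constrained at `t` too since `k` is antitone, so separation applies at `l` and pushes `y` out
  -- of the ball.
  have hagree : ∀ t l, t < k l → i t l = j t l := by
    intro t
    induction t using Nat.strong_induction_on with
    | _ t iht =>
    by_contra! hc
    obtain ⟨l, ⟨hlt, hne⟩, hmin⟩ := exists_minimal_of_wellFoundedLT
      (fun l : Fin d => t < k l ∧ i t l ≠ j t l) hc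
    have hpre : ∀ m, m < l → i t m = j t m := fun m hm => by
      by_contra hne'
      exact absurd (hmin ⟨hlt.trans_le (hk hm.le), hne'⟩ hm.le) hm.not_ge
    have h1 := one_le_pow_mul_abs_sub t (k l) (fun t => i t l) (fun t => j t l) (x l) (y l)
      (fun m => (i m l).2) (fun m => (j m l).2) hlt
      (fun m hm => congrArg Fin.val (iht m hm l (hm.trans hlt)))
      (hsep l _ (hi t) _ (hj t) hpre hne) (hx l) (hyk l)
    have hn0 : (1 : ℝ) ≤ n l := by exact_mod_cast (hn1 l).le
    have h2 : (n l : ℝ) ^ (t + 1) ≤ (n l : ℝ) ^ k l := pow_le_pow_right₀ hn0 hlt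
    have h3 : (n l : ℝ) ^ (t + 1) * |x l - y l| < (n l : ℝ) ^ (t + 1) * r :=
      mul_lt_mul_of_pos_left (hxy l) (by positivity)
    have h4 := mul_le_mul_of_nonneg_right h2 hr.le
    linarith [hkr l (by omega)]
  intro l
  rw [digitInterval_congr (k l) _ (fun t => (j t l : ℕ)) fun t ht =>
    congrArg Fin.val (hagree t l ht)]
  exact hyk l

/-- Sides shorter than `R / d` bound the diameter; `d` is a crude substitute for `√d`. -/
theorem approxCube_subset_ball {d : ℕ} {n : Fin d → ℕ} {k : Fin d → ℕ}
    {i : ℕ → ∀ l, Fin (n l)} {x : EuclideanSpace ℝ (Fin d)} (hx : x ∈ approxCube n k i) {R : ℝ}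
    (hR : 0 < R) (hkR : ∀ l, (d : ℝ) < (n l : ℝ) ^ k l * R) :
    approxCube n k i ⊆ Metric.ball x R := by
  intro y hy
  rw [Metric.mem_ball, EuclideanSpace.dist_eq, Real.sqrt_lt' hR]
  rcases Nat.eq_zero_or_pos d with rfl | hd
  · simpa using by positivity
  have : Nonempty (Fin d) := ⟨⟨0, hd⟩⟩
  have hd1 : (1 : ℝ) ≤ d := by exact_mod_cast hd
  have h : ∀ l, dist (y l) (x l) < R / d := fun l => by
    have h1 := pow_mul_abs_sub_le_one _ _ _ _ (hy l) (hx l)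
    have h2 := hkR l
    have h3 : (0 : ℝ) < (n l : ℝ) ^ k l := by
      by_contra! hc
      nlinarith
    rw [Real.dist_eq, lt_div_iff₀ (by linarith)]
    have h4 := abs_nonneg (y l - x l)
    by_contra! hc
    have h5 : (n l : ℝ) ^ k l * R ≤ (n l : ℝ) ^ k l * |y l - x l| * d := by
      rw [mul_assoc]
      exact mul_le_mul_of_nonneg_left hc h3.le
    nlinarith
  calc ∑ l, dist (y l) (x l) ^ 2 < ∑ _l : Fin d, (R / d) ^ 2 :=
        Finset.sum_lt_sum_of_nonempty Finset.univ_nonempty fun l _ =>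
          pow_lt_pow_left₀ (h l) dist_nonneg two_ne_zero
    _ = R ^ 2 / d := by
        rw [Finset.sum_const, Finset.card_univ, Fintype.card_fin, nsmul_eq_mul]
        field_simp
    _ ≤ R ^ 2 := div_le_self (by positivity) hd1

/-! ### Levels adapted to a scale. -/

theorem antitone_div_log {d : ℕ} {n : Fin d → ℕ} (hn : StrictMono n) (hn1 : ∀ l, 1 < n l) {a : ℝ}
    (ha : 0 ≤ a) : Antitone fun l => a / Real.log (n l) := fun l l' h => by
  have h0 : 0 < Real.log (n l) := Real.log_pos (by exact_mod_cast hn1 l)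
  refine div_le_div_of_nonneg_left ha h0 (Real.log_le_log ?_ ?_)
  · exact_mod_cast zero_lt_one.trans (hn1 l)
  · exact_mod_cast hn.monotone h

/-- The largest levels at which the sides of the approximate cubes are at least `R`. -/
noncomputable def floorLevel {d : ℕ} (n : Fin d → ℕ) (R : ℝ) (l : Fin d) : ℕ :=
  ⌊-Real.log R / Real.log (n l)⌋₊

/-- The smallest levels at which the sides of the approximate cubes are at most `R`. -/
noncomputable def ceilLevel {d : ℕ} (n : Fin d → ℕ) (R : ℝ) (l : Fin d) : ℕ :=
  ⌈-Real.log R / Real.log (n l)⌉₊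

theorem antitone_floorLevel {d : ℕ} {n : Fin d → ℕ} (hn : StrictMono n) (hn1 : ∀ l, 1 < n l)
    (R : ℝ) : Antitone (floorLevel n R) := fun l l' h => by
  rcases le_total 0 (-Real.log R) with h0 | h0
  · exact Nat.floor_mono (antitone_div_log hn hn1 h0 h)
  · rw [floorLevel, Nat.floor_of_nonpos]
    · exact Nat.zero_le _
    · exact div_nonpos_of_nonpos_of_nonneg h0 (Real.log_natCast_nonneg _)

theorem antitone_ceilLevel {d : ℕ} {n : Fin d → ℕ} (hn : StrictMono n) (hn1 : ∀ l, 1 < n l)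
    (R : ℝ) : Antitone (ceilLevel n R) := fun l l' h => by
  rcases le_total 0 (-Real.log R) with h0 | h0
  · exact Nat.ceil_mono (antitone_div_log hn hn1 h0 h)
  · rw [ceilLevel, Nat.ceil_eq_zero.2]
    · exact Nat.zero_le _
    · exact div_nonpos_of_nonpos_of_nonneg h0 (Real.log_natCast_nonneg _)

theorem log_pow_mul {n : ℕ} (hn1 : 1 < n) {R : ℝ} (hR : 0 < R) (k : ℕ) :
    Real.log ((n : ℝ) ^ k * R) = k * Real.log n + Real.log R := by
  have : (n : ℝ) ≠ 0 := by exact_mod_cast (zero_lt_one.trans hn1).ne'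
  rw [Real.log_mul (pow_ne_zero _ this) hR.ne', Real.log_pow]

theorem pow_mul_pos {n : ℕ} (hn1 : 1 < n) {R : ℝ} (hR : 0 < R) (k : ℕ) : 0 < (n : ℝ) ^ k * R :=
  mul_pos (pow_pos (by exact_mod_cast zero_lt_one.trans hn1) _) hR

theorem pow_floorLevel_mul_le_one {d : ℕ} {n : Fin d → ℕ} (hn1 : ∀ l, 1 < n l) {R : ℝ}
    (hR : 0 < R) {l : Fin d} (h : floorLevel n R l ≠ 0) :
    (n l : ℝ) ^ floorLevel n R l * R ≤ 1 := by
  have h0 : 0 < Real.log (n l) := Real.log_pos (by exact_mod_cast hn1 l)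
  have h1 := (le_div_iff₀ h0).1 ((Nat.le_floor_iff' h).1 le_rfl)
  refine (Real.log_nonpos_iff (pow_mul_pos (hn1 l) hR _).le).1 ?_
  rw [log_pow_mul (hn1 l) hR]
  linarith

theorem one_lt_pow_floorLevel_succ_mul {d : ℕ} {n : Fin d → ℕ} (hn1 : ∀ l, 1 < n l) {R : ℝ}
    (hR : 0 < R) (l : Fin d) : 1 < (n l : ℝ) ^ (floorLevel n R l + 1) * R := by
  have h0 : 0 < Real.log (n l) := Real.log_pos (by exact_mod_cast hn1 l)
  have h1 := (div_lt_iff₀ h0).1 (Nat.lt_floor_add_one (-Real.log R / Real.log (n l)))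
  refine (Real.log_pos_iff (pow_mul_pos (hn1 l) hR _).le).1 ?_
  rw [log_pow_mul (hn1 l) hR, Nat.cast_add_one]
  change -Real.log R < ((floorLevel n R l : ℝ) + 1) * _ at h1
  linarith

theorem one_le_pow_ceilLevel_mul {d : ℕ} {n : Fin d → ℕ} (hn1 : ∀ l, 1 < n l) {R : ℝ}
    (hR : 0 < R) (l : Fin d) : 1 ≤ (n l : ℝ) ^ ceilLevel n R l * R := by
  have h0 : 0 < Real.log (n l) := Real.log_pos (by exact_mod_cast hn1 l)
  have h1 := (div_le_iff₀ h0).1 (Nat.le_ceil (-Real.log R / Real.log (n l)))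
  refine (Real.log_nonneg_iff (pow_mul_pos (hn1 l) hR _)).1 ?_
  rw [log_pow_mul (hn1 l) hR]
  change -Real.log R ≤ (ceilLevel n R l : ℝ) * _ at h1
  linarith

theorem pow_ceilLevel_mul_lt {d : ℕ} {n : Fin d → ℕ} (hn1 : ∀ l, 1 < n l) {R : ℝ}
    (hR : 0 < R) {l : Fin d} (h : ceilLevel n R l ≠ 0) :
    (n l : ℝ) ^ ceilLevel n R l * R < n l := by
  have h0 : 0 < Real.log (n l) := Real.log_pos (by exact_mod_cast hn1 l)
  have h1 : 0 ≤ -Real.log R / Real.log (n l) := by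
    by_contra! hc
    exact h (Nat.ceil_eq_zero.2 hc.le)
  have h2 : (ceilLevel n R l : ℝ) - 1 < -Real.log R / Real.log (n l) := by
    have := Nat.ceil_lt_add_one h1
    change (ceilLevel n R l : ℝ) < _ at this
    linarith
  have h3 := (lt_div_iff₀ h0).1 h2
  refine (Real.log_lt_log_iff (pow_mul_pos (hn1 l) hR _)
    (by exact_mod_cast zero_lt_one.trans (hn1 l))).1 ?_
  rw [log_pow_mul (hn1 l) hR]
  linarith

theorem floorLevel_le_ceilLevel {d : ℕ} {n : Fin d → ℕ} {r R : ℝ} (hr : 0 < r) (h : r ≤ R) :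
    floorLevel n R ≤ ceilLevel n r := fun l => by
  refine (Nat.floor_mono ?_).trans (Nat.floor_le_ceil _)
  have := Real.log_le_log hr h
  exact div_le_div_of_nonneg_right (by linarith) (Real.log_natCast_nonneg _)

/-! ### Exponents and counting added digits. -/

/-- The exponent contributed by the direction `l`. -/
noncomputable def sideExponent {d : ℕ} (n : Fin d → ℕ) (I : Finset (∀ l, Fin (n l)))
    (hI : I.Nonempty) (p : (∀ l, Fin (n l)) → ℝ) (l : Fin d) : ℝ :=
  I.sup' hI fun i => -Real.log (condDigitProb n I p l i) / Real.log (n l)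

theorem rpow_neg_sideExponent_le {d : ℕ} {n : Fin d → ℕ} (hn1 : ∀ l, 1 < n l)
    {I : Finset (∀ l, Fin (n l))} (hI : I.Nonempty) {p : (∀ l, Fin (n l)) → ℝ}
    (hp : IsPosProbVector I p) (l : Fin d) {i : ∀ l, Fin (n l)} (hi : i ∈ I) :
    (n l : ℝ) ^ (-sideExponent n I hI p l) ≤ condDigitProb n I p l i := by
  have h0 : 0 < Real.log (n l) := Real.log_pos (by exact_mod_cast hn1 l)
  have hn0 : (0 : ℝ) < n l := by exact_mod_cast zero_lt_one.trans (hn1 l)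
  have h1 := Finset.le_sup' (fun i => -Real.log (condDigitProb n I p l i) / Real.log (n l)) hi
  have h2 := (div_le_iff₀ h0).1 h1
  refine (Real.log_le_log_iff (Real.rpow_pos_of_pos hn0 _) (condDigitProb_pos hp hi l)).1 ?_
  rw [Real.log_rpow hn0, sideExponent]
  linarith

theorem exists_condDigitProb_eq {d : ℕ} {n : Fin d → ℕ} (hn1 : ∀ l, 1 < n l)
    {I : Finset (∀ l, Fin (n l))} (hI : I.Nonempty) {p : (∀ l, Fin (n l)) → ℝ}
    (hp : IsPosProbVector I p) (l : Fin d) :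
    ∃ i ∈ I, condDigitProb n I p l i = (n l : ℝ) ^ (-sideExponent n I hI p l) := by
  have h0 : 0 < Real.log (n l) := Real.log_pos (by exact_mod_cast hn1 l)
  have hn0 : (0 : ℝ) < n l := by exact_mod_cast zero_lt_one.trans (hn1 l)
  obtain ⟨i, hi, h⟩ := Finset.exists_mem_eq_sup' hI
    fun i => -Real.log (condDigitProb n I p l i) / Real.log (n l)
  refine ⟨i, hi, Real.log_injOn_pos (condDigitProb_pos hp hi l) (Real.rpow_pos_of_pos hn0 _) ?_⟩
  rw [Real.log_rpow hn0, sideExponent, h]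
  field_simp

theorem sideExponent_nonneg {d : ℕ} {n : Fin d → ℕ} {I : Finset (∀ l, Fin (n l))}
    (hI : I.Nonempty) {p : (∀ l, Fin (n l)) → ℝ} (hp : IsPosProbVector I p) (l : Fin d) :
    0 ≤ sideExponent n I hI p l := by
  obtain ⟨i, hi⟩ := hI
  refine le_trans ?_
    (Finset.le_sup' (fun i => -Real.log (condDigitProb n I p l i) / Real.log (n l)) hi)
  refine div_nonneg ?_ (Real.log_natCast_nonneg _)
  linarith [Real.log_nonpos (condDigitProb_pos hp hi l).le (condDigitProb_le_one hp i l)]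

/-- Each of the two roundings costs at most one factor `n`, hence `n ^ 2`. The bound `1 ≤ c` handles
`k = 0`, where truncation makes the ceiling estimate unavailable. -/
theorem pow_sub_le_of_levels {n K k : ℕ} (hn1 : 1 < n) (hKk : K ≤ k) {ρ R c : ℝ} (hρ : 0 < ρ)
    (hK : 1 < (n : ℝ) ^ (K + 1) * R) (hk : k ≠ 0 → (n : ℝ) ^ k * ρ < n)
    (hc : (n : ℝ) ^ 2 * R / ρ ≤ c) (hc1 : 1 ≤ c) : (n : ℝ) ^ (k - K) ≤ c := by
  have hn0 : (0 : ℝ) < n := by exact_mod_cast zero_lt_one.trans hn1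
  rcases eq_or_ne k 0 with rfl | hk0
  · simpa using hc1
  refine le_trans ((le_div_iff₀ hρ).2 ?_) hc
  have h1 : (n : ℝ) ^ (k - K) * n ^ K = n ^ k := by rw [← pow_add, Nat.sub_add_cancel hKk]
  have h2 := hk hk0
  rw [pow_succ] at hK
  have hKp : (0 : ℝ) < (n : ℝ) ^ K := by positivity
  rw [← h1] at h2
  have h3 : (n : ℝ) ^ (k - K) * ρ * n ^ K < n := by linarith
  have h4 : 0 < (n : ℝ) ^ (k - K) * ρ := by positivity
  have h5 : (n : ℝ) ^ (k - K) * ρ ≤ (n : ℝ) ^ (k - K) * ρ * (n ^ K * n * R) :=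
    le_mul_of_one_le_right h4.le hK.le
  have hR : 0 < R := by
    by_contra! hc
    nlinarith [mul_pos hKp hn0]
  nlinarith [mul_lt_mul_of_pos_right h3 (mul_pos hn0 hR)]

theorem le_pow_sub_of_levels {n K k : ℕ} (hn1 : 1 < n) (hKk : K ≤ k) {ρ r : ℝ} (hρ : 0 < ρ)
    (hρn : ρ ≤ n) (hr : 0 < r) (hk : 1 < (n : ℝ) ^ (k + 1) * r)
    (hK : K ≠ 0 → (n : ℝ) ^ K * ρ < n) : ρ / ((n : ℝ) ^ 2 * r) ≤ (n : ℝ) ^ (k - K) := by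
  have hn0 : (0 : ℝ) < n := by exact_mod_cast zero_lt_one.trans hn1
  have hK' : (n : ℝ) ^ K * ρ ≤ n := by
    rcases eq_or_ne K 0 with rfl | hK0
    · simpa using hρn
    · exact (hK hK0).le
  rw [div_le_iff₀ (by positivity)]
  have h1 : (n : ℝ) ^ (k - K) * n ^ K = n ^ k := by rw [← pow_add, Nat.sub_add_cancel hKk]
  rw [pow_succ, ← h1] at hk
  have hKp : (0 : ℝ) < (n : ℝ) ^ K := by positivity
  have h2 : 0 < (n : ℝ) ^ (k - K) := by positivity
  calc ρ ≤ ρ * ((n : ℝ) ^ (k - K) * n ^ K * n * r) := le_mul_of_one_le_right hρ.le hk.le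
    _ = ((n : ℝ) ^ K * ρ) * ((n : ℝ) ^ (k - K) * n * r) := by ring
    _ ≤ n * ((n : ℝ) ^ (k - K) * n * r) := mul_le_mul_of_nonneg_right hK' (by positivity)
    _ = _ := by ring

theorem prod_range_mul_pow_le {a : ℕ → ℝ} {b : ℝ} (hb : 0 ≤ b) (ha : ∀ t, b ≤ a t) {K k : ℕ}
    (hKk : K ≤ k) :
    (∏ t ∈ Finset.range K, a t) * b ^ (k - K) ≤ ∏ t ∈ Finset.range k, a t := by
  rw [← Finset.prod_range_mul_prod_Ico a hKk]
  refine mul_le_mul_of_nonneg_left ?_ (Finset.prod_nonneg fun t _ => hb.trans (ha t))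
  calc b ^ (k - K) = ∏ _t ∈ Finset.Ico K k, b := by simp
    _ ≤ _ := Finset.prod_le_prod (fun _ _ => hb) fun t _ => ha t

theorem rpow_neg_pow {x : ℝ} (hx : 0 ≤ x) (s : ℝ) (m : ℕ) : (x ^ (-s)) ^ m = ((x ^ m) ^ s)⁻¹ := by
  rw [← Real.rpow_natCast (x ^ (-s)), ← Real.rpow_mul hx, ← Real.rpow_natCast x,
    ← Real.rpow_mul hx, ← Real.rpow_neg hx]
  ring_nf

/-! ### The upper bound. -/

theorem IsSelfAffineMeasure.measureReal_ball_le {d : ℕ} {n : Fin d → ℕ} (hn : StrictMono n)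
    (hn1 : ∀ l, 1 < n l) {I : Finset (∀ l, Fin (n l))} (hI : I.Nonempty)
    (hsep : VeryStrongSeparation n I) {p : (∀ l, Fin (n l)) → ℝ} (hp : IsPosProbVector I p)
    {μ : Measure (EuclideanSpace ℝ (Fin d))} (hμ : IsSelfAffineMeasure n I p μ)
    {x : EuclideanSpace ℝ (Fin d)} (hx : x ∈ μ.support) {r R : ℝ} (hr : 0 < r) (hrR : r < R) :
    μ.real (Metric.ball x R) ≤
      (∏ l, ((n l : ℝ) ^ 2 * (d + 1) * (R / r)) ^ sideExponent n I hI p l) *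
        μ.real (Metric.ball x r) := by
  have := hμ.isProbabilityMeasure
  have hd1 : (1 : ℝ) ≤ (d : ℝ) + 1 := by linarith [(Nat.cast_nonneg d : (0 : ℝ) ≤ d)]
  -- Dividing by `d + 1` gives the strict inequality `d < (n l) ^ k l * r` needed to fit the cube
  -- inside the ball.
  set ρ := r / ((d : ℝ) + 1) with hρ
  have hρ0 : 0 < ρ := by positivity
  have hρr : ρ ≤ r := div_le_self hr.le hd1
  set K := floorLevel n R
  set k := ceilLevel n ρ
  have hKk : K ≤ k := floorLevel_le_ceilLevel hρ0 (hρr.trans hrR.le)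
  obtain ⟨i, hi, hxi⟩ := hμ.exists_digits hn1 hI hp hx (Finset.univ.sup k)
  have hxk : x ∈ approxCube n k i := fun l =>
    digitInterval_anti (fun t => (i t l).2) (Finset.le_sup (Finset.mem_univ l)) (hxi l)
  have hK := antitone_floorLevel hn hn1 R
  have hk := antitone_ceilLevel hn hn1 ρ
  have h1 : μ.real (Metric.ball x R) ≤ μ.real (approxCube n K i) :=
    ENNReal.toReal_mono (measure_ne_top _ _) (hμ.measure_ball_le_approxCube hn1 hI hsep hp hK hi
      (approxCube_subset hKk i hxk) (hr.trans hrR)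
      fun l hl => pow_floorLevel_mul_le_one hn1 (hr.trans hrR) hl)
  have h2 : μ.real (approxCube n k i) ≤ μ.real (Metric.ball x r) := by
    refine measureReal_mono (approxCube_subset_ball hxk hr fun l => ?_)
    have h := one_le_pow_ceilLevel_mul hn1 hρ0 l
    rw [hρ, mul_div_assoc', one_le_div (by positivity)] at h
    linarith
  have h3 : μ.real (approxCube n K i) ≤
      (∏ l, ((n l : ℝ) ^ 2 * (d + 1) * (R / r)) ^ sideExponent n I hI p l) *
        μ.real (approxCube n k i) := by
    rw [hμ.measureReal_approxCube hn1 hsep hp _ K i hK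
        (fun l => Finset.le_sup (Finset.mem_univ l)) hi,
      hμ.measureReal_approxCube hn1 hsep hp _ k i hk
        (fun l => Finset.le_sup (Finset.mem_univ l)) hi, ← Finset.prod_mul_distrib]
    refine Finset.prod_le_prod
      (fun l _ => Finset.prod_nonneg fun t _ => (condDigitProb_pos hp (hi t) l).le) fun l _ => ?_
    have hn0 : (0 : ℝ) < n l := by exact_mod_cast zero_lt_one.trans (hn1 l)
    have hn1' : (1 : ℝ) ≤ n l := by exact_mod_cast (hn1 l).le
    have h4 := prod_range_mul_pow_le (Real.rpow_nonneg hn0.le _)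
      (fun t => rpow_neg_sideExponent_le hn1 hI hp l (hi t)) (hKk l)
    rw [rpow_neg_pow hn0.le, ← div_eq_mul_inv, div_le_iff₀ (by positivity)] at h4
    rw [mul_comm]
    refine h4.trans (mul_le_mul_of_nonneg_left ?_
      (Finset.prod_nonneg fun t _ => (condDigitProb_pos hp (hi t) l).le))
    refine Real.rpow_le_rpow (by positivity) ?_ (sideExponent_nonneg hI hp l)
    refine pow_sub_le_of_levels (hn1 l) (hKk l) hρ0
      (one_lt_pow_floorLevel_succ_mul hn1 (hr.trans hrR) l)
      (fun h => pow_ceilLevel_mul_lt hn1 hρ0 h) (le_of_eq ?_) ?_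
    · rw [hρ]; field_simp
    · have h5 : 1 ≤ R / r := (one_le_div hr).2 hrR.le
      exact one_le_mul_of_one_le_of_one_le
        (one_le_mul_of_one_le_of_one_le (one_le_pow₀ hn1') hd1) h5
  exact h1.trans (h3.trans (mul_le_mul_of_nonneg_left h2
    (Finset.prod_nonneg fun l _ => Real.rpow_nonneg
      (by have := hr.trans hrR; positivity) _)))

/-! ### Sharpness: an extremal cube. -/

theorem ceilLevel_le_floorLevel {d : ℕ} {n : Fin d → ℕ} (hn1 : ∀ l, 1 < n l) {r R : ℝ}
    {l : Fin d} (hR1 : R ≤ 1) (hR : 0 < R)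
    (h : Real.log (n l) - Real.log R ≤ -Real.log r) :
    ceilLevel n R l ≤ floorLevel n r l := by
  have h0 : 0 < Real.log (n l) := Real.log_pos (by exact_mod_cast hn1 l)
  have h1 : 0 ≤ -Real.log R / Real.log (n l) :=
    div_nonneg (by linarith [Real.log_nonpos hR.le hR1]) h0.le
  refine Nat.le_floor ((Nat.ceil_lt_add_one h1).le.trans ?_)
  rw [← div_self h0.ne', ← add_div]
  exact div_le_div_of_nonneg_right (by linarith) h0.le

theorem floorLevel_le_ceilLevel_of_lt {d : ℕ} {n : Fin d → ℕ} {r R : ℝ} {l l' : Fin d}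
    (h : -Real.log r / Real.log (n l') ≤ -Real.log R / Real.log (n l)) :
    floorLevel n r l' ≤ ceilLevel n R l :=
  (Nat.floor_mono h).trans (Nat.floor_le_ceil _)

theorem IsSelfAffineMeasure.exists_le_measureReal_ball {d : ℕ} {n : Fin d → ℕ} (hn : StrictMono n)
    (hn1 : ∀ l, 1 < n l) {I : Finset (∀ l, Fin (n l))} (hI : I.Nonempty)
    (hsep : VeryStrongSeparation n I) {p : (∀ l, Fin (n l)) → ℝ} (hp : IsPosProbVector I p)
    {μ : Measure (EuclideanSpace ℝ (Fin d))} (hμ : IsSelfAffineMeasure n I p μ) {T : ℝ}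
    (hT0 : 0 < T) (hT : ∀ l, Real.log (n l) + Real.log (d + 1) ≤ T) :
    ∃ r R : ℝ, 0 < r ∧ r < R ∧ R / r = Real.exp T ∧ ∃ x ∈ μ.support,
      (∏ l, (((n l : ℝ) ^ 2 * (d + 1))⁻¹ * Real.exp T) ^ sideExponent n I hI p l) *
        μ.real (Metric.ball x r) ≤ μ.real (Metric.ball x R) := by
  have := hμ.isProbabilityMeasure
  have hd1 : (1 : ℝ) ≤ (d : ℝ) + 1 := by linarith [(Nat.cast_nonneg d : (0 : ℝ) ≤ d)]
  have hlogpos : ∀ l, 0 < Real.log (n l) := fun l => Real.log_pos (by exact_mod_cast hn1 l)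
  -- With `R = exp (-y)` and `T` fixed, both sides grow linearly in `y`, the right one faster since
  -- `log (n l) < log (n l')`. This puts the added positions of `l'` before those of `l`.
  obtain ⟨y, hy0, hy⟩ : ∃ y : ℝ, 0 ≤ y ∧ ∀ l l' : Fin d, l < l' →
      (y + T) / Real.log (n l') ≤ (y + Real.log (d + 1)) / Real.log (n l) := by
    have hev : ∀ l l' : Fin d, ∀ᶠ y : ℝ in Filter.atTop, l < l' →
        (y + T) / Real.log (n l') ≤ (y + Real.log (d + 1)) / Real.log (n l) := fun l l' => by
      by_cases hll : l < l'
      · have hlt : Real.log (n l) < Real.log (n l') :=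
          Real.log_lt_log (by exact_mod_cast zero_lt_one.trans (hn1 l)) (by exact_mod_cast hn hll)
        filter_upwards [Filter.eventually_ge_atTop
          (T * Real.log (n l) / (Real.log (n l') - Real.log (n l)))] with y hy _
        rw [div_le_iff₀ (sub_pos.2 hlt)] at hy
        rw [div_le_div_iff₀ (hlogpos l') (hlogpos l)]
        have := mul_nonneg (Real.log_nonneg hd1) (hlogpos l').le
        nlinarith
      · exact Filter.Eventually.of_forall fun y h => absurd h hll
    have h := (Filter.eventually_ge_atTop (0 : ℝ)).and
      (Filter.eventually_all.2 fun l => Filter.eventually_all.2 (hev l))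
    exact h.exists
  set R := Real.exp (-y) with hRdef
  set r := Real.exp (-(y + T)) with hrdef
  set ρ := R / ((d : ℝ) + 1) with hρ
  have hR0 : 0 < R := Real.exp_pos _
  have hr0 : 0 < r := Real.exp_pos _
  have hR1 : R ≤ 1 := Real.exp_le_one_iff.2 (by linarith)
  have hρ0 : 0 < ρ := by positivity
  have hρR : ρ ≤ R := div_le_self hR0.le hd1
  have hlogr : -Real.log r = y + T := by rw [hrdef, Real.log_exp, neg_neg]
  have hlogρ : -Real.log ρ = y + Real.log (d + 1) := by
    rw [hρ, Real.log_div hR0.ne' (by positivity), hRdef, Real.log_exp]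
    ring
  have hRr : R / r = Real.exp T := by
    rw [hRdef, hrdef, ← Real.exp_sub]
    ring_nf
  set K := ceilLevel n ρ with hKdef
  set k := floorLevel n r with hkdef
  have hKk : K ≤ k := fun l =>
    ceilLevel_le_floorLevel hn1 (hρR.trans hR1) hρ0 (by linarith [hT l])
  have hdisj : ∀ l l' : Fin d, l < l' → k l' ≤ K l := fun l l' h =>
    floorLevel_le_ceilLevel_of_lt (by rw [hlogr, hlogρ]; exact hy l l' h)
  choose e heI he using exists_condDigitProb_eq hn1 hI hp
  obtain ⟨i, hi, hie⟩ : ∃ i : ℕ → ∀ l, Fin (n l), (∀ t, i t ∈ I) ∧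
      ∀ l t, K l ≤ t → t < k l → i t = e l := by
    classical
    -- At most one `l` qualifies, by `hdisj`, so the choice is forced; positions outside all ranges
    -- take an arbitrary element of `I`.
    refine ⟨fun t => if h : ∃ l, K l ≤ t ∧ t < k l then e h.choose else hI.choose,
      fun t => ?_, fun l t h1 h2 => ?_⟩
    · dsimp only
      split_ifs
      exacts [heI _, hI.choose_spec]
    · have h : ∃ l, K l ≤ t ∧ t < k l := ⟨l, h1, h2⟩
      have hs := h.choose_spec
      dsimp only
      rw [dif_pos h]
      congr 1
      rcases lt_trichotomy h.choose l with hlt | heq | hgt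
      · have := hdisj _ _ hlt
        omega
      · exact heq
      · have := hdisj _ _ hgt
        omega
  have hK := antitone_ceilLevel hn hn1 ρ
  have hk := antitone_floorLevel hn hn1 r
  have hmk := hμ.measureReal_approxCube hn1 hsep hp _ k i hk
    (fun l => Finset.le_sup (Finset.mem_univ l)) hi
  have hmK := hμ.measureReal_approxCube hn1 hsep hp _ K i hK
    (fun l => Finset.le_sup (Finset.mem_univ l)) hi
  have hpos : 0 < μ.real (approxCube n k i) := by
    rw [hmk]
    exact Finset.prod_pos fun l _ => Finset.prod_pos fun t _ => condDigitProb_pos hp (hi t) l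
  -- The smaller cube has positive mass, so it supplies a centre in the support.
  obtain ⟨x, hxk, hxs⟩ := Measure.nonempty_inter_support_of_pos (ENNReal.toReal_pos_iff.1 hpos).1
  refine ⟨r, R, hr0, Real.exp_lt_exp.2 (by linarith), hRr, x, hxs, ?_⟩
  have h1 : μ.real (Metric.ball x r) ≤ μ.real (approxCube n k i) :=
    ENNReal.toReal_mono (measure_ne_top _ _) (hμ.measure_ball_le_approxCube hn1 hI hsep hp hk hi
      hxk hr0 fun l hl => pow_floorLevel_mul_le_one hn1 hr0 hl)
  have h2 : μ.real (approxCube n K i) ≤ μ.real (Metric.ball x R) := by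
    refine measureReal_mono (approxCube_subset_ball (approxCube_subset hKk i hxk) hR0 fun l => ?_)
    have h := one_le_pow_ceilLevel_mul hn1 hρ0 l
    rw [hρ, mul_div_assoc', one_le_div (by positivity)] at h
    linarith
  refine (mul_le_mul_of_nonneg_left h1 (Finset.prod_nonneg fun l _ => by positivity)).trans
    (le_trans ?_ h2)
  rw [hmk, hmK, ← Finset.prod_mul_distrib]
  refine Finset.prod_le_prod (fun l _ => mul_nonneg (by positivity)
    (Finset.prod_nonneg fun t _ => (condDigitProb_pos hp (hi t) l).le)) fun l _ => ?_
  have hn0 : (0 : ℝ) < n l := by exact_mod_cast zero_lt_one.trans (hn1 l)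
  have h3 : ∏ t ∈ Finset.Ico (K l) (k l), condDigitProb n I p l (i t) =
      (((n l : ℝ) ^ (k l - K l)) ^ sideExponent n I hI p l)⁻¹ := by
    rw [← rpow_neg_pow hn0.le, ← he l, ← Nat.card_Ico]
    refine Finset.prod_eq_pow_card fun t ht => ?_
    rw [hie l t (Finset.mem_Ico.1 ht).1 (Finset.mem_Ico.1 ht).2]
  have h4 : ((n l : ℝ) ^ 2 * (d + 1))⁻¹ * Real.exp T ≤ (n l : ℝ) ^ (k l - K l) := by
    refine le_trans (le_of_eq ?_) (le_pow_sub_of_levels (hn1 l) (hKk l) hρ0 ?_ hr0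
      (one_lt_pow_floorLevel_succ_mul hn1 hr0 l) fun h => pow_ceilLevel_mul_lt hn1 hρ0 h)
    · rw [← hRr, hρ]; field_simp
    · exact (hρR.trans hR1).trans (by exact_mod_cast (hn1 l).le)
  rw [← Finset.prod_range_mul_prod_Ico _ (hKk l), h3, mul_left_comm]
  refine mul_le_of_le_one_right
    (Finset.prod_nonneg fun t _ => (condDigitProb_pos hp (hi t) l).le) ?_
  rw [← div_eq_mul_inv]
  exact div_le_one_of_le₀ (Real.rpow_le_rpow (by positivity) h4 (sideExponent_nonneg hI hp l))
    (by positivity)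

/-! ### From ball estimates to the dimension. -/

theorem prod_mul_rpow {ι : Type*} [Fintype ι] (c s : ι → ℝ) (hc : ∀ l, 0 ≤ c l) {a : ℝ}
    (ha : 0 < a) : ∏ l, (c l * a) ^ s l = (∏ l, c l ^ s l) * a ^ ∑ l, s l := by
  rw [Real.rpow_sum_of_pos ha, ← Finset.prod_mul_distrib]
  exact Finset.prod_congr rfl fun l _ => Real.mul_rpow (hc l) ha.le

theorem measureReal_ball_pos {X : Type*} [PseudoMetricSpace X] [MeasurableSpace X]
    {μ : Measure X} [IsFiniteMeasure μ] {x : X} (hx : x ∈ μ.support) {r : ℝ} (hr : 0 < r) :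
    0 < μ.real (Metric.ball x r) :=
  ENNReal.toReal_pos ((Measure.mem_support_iff_forall x).1 hx _ (Metric.ball_mem_nhds x hr)).ne'
    (measure_ne_top _ _)

theorem measure_ball_div_le_ofReal_iff {X : Type*} [PseudoMetricSpace X] [MeasurableSpace X]
    {μ : Measure X} [IsFiniteMeasure μ] {x : X} (hx : x ∈ μ.support) {r R c : ℝ} (hr : 0 < r)
    (hc : 0 ≤ c) :
    μ (Metric.ball x R) / μ (Metric.ball x r) ≤ ENNReal.ofReal c ↔
      μ.real (Metric.ball x R) ≤ c * μ.real (Metric.ball x r) := by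
  have h := measureReal_ball_pos hx hr
  rw [← ofReal_measureReal, ← ofReal_measureReal, ← ENNReal.ofReal_div_of_pos h,
    ENNReal.ofReal_le_ofReal_iff hc, div_le_iff₀ h]

theorem theorem2p5 {d : ℕ} (hd : 2 ≤ d) (n : Fin d → ℕ) (hn : StrictMono n)
    (hn1 : ∀ l, 1 < n l) (I : Finset (∀ l, Fin (n l))) (hI : I.Nonempty)
    (hsep : VeryStrongSeparation n I) (p : (∀ l, Fin (n l)) → ℝ) (hp : IsPosProbVector I p)
    (μ : Measure (EuclideanSpace ℝ (Fin d))) (hμ : IsSelfAffineMeasure n I p μ) :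
    upperRegularityDim μ =
      ((∑ l : Fin d, I.sup' hI fun i =>
        -Real.log (condDigitProb n I p l i) / Real.log (n l) : ℝ) : EReal) := by
  have := hμ.isProbabilityMeasure
  have hn0 : ∀ l, (0 : ℝ) < n l := fun l => by exact_mod_cast zero_lt_one.trans (hn1 l)
  change _ = ((∑ l : Fin d, sideExponent n I hI p l : ℝ) : EReal)
  set σ := ∑ l : Fin d, sideExponent n I hI p l with hσ
  have hσ0 : 0 ≤ σ := Finset.sum_nonneg fun l _ => sideExponent_nonneg hI hp l
  refine le_antisymm (sInf_le ⟨σ, ⟨hσ0,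
    ∏ l, ((n l : ℝ) ^ 2 * (d + 1)) ^ sideExponent n I hI p l,
    Finset.prod_pos fun l _ => Real.rpow_pos_of_pos (by have := hn0 l; positivity) _,
    fun r R hr hrR x hx => ?_⟩, rfl⟩) (le_sInf ?_)
  · have hR := hr.trans hrR
    rw [measure_ball_div_le_ofReal_iff hx hr (mul_nonneg
        (Finset.prod_nonneg fun l _ => by positivity) (by positivity)), hσ,
      ← prod_mul_rpow _ _ (fun l => by positivity) (by positivity)]
    exact hμ.measureReal_ball_le hn hn1 hI hsep hp hx hr hrR
  · rintro _ ⟨s, ⟨-, C, hC, hs⟩, rfl⟩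
    refine EReal.coe_le_coe_iff.2 ?_
    by_contra! hlt
    set c := ∏ l, (((n l : ℝ) ^ 2 * (d + 1))⁻¹) ^ sideExponent n I hI p l with hc
    have hc0 : 0 < c :=
      Finset.prod_pos fun l _ => Real.rpow_pos_of_pos (by have := hn0 l; positivity) _
    -- For `s < σ`, the extremal balls would force `c * exp (T * σ) ≤ C * exp (T * s)`, which fails
    -- for large `T`.
    have hev : ∀ᶠ T : ℝ in Filter.atTop, 0 < T ∧
        (∀ l, Real.log (n l) + Real.log (d + 1) ≤ T) ∧ C / c < Real.exp (T * (σ - s)) :=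
      (Filter.eventually_gt_atTop 0).and ((Filter.eventually_all.2 fun l =>
        Filter.eventually_ge_atTop _).and ((Real.tendsto_exp_atTop.comp
          (Filter.tendsto_id.atTop_mul_const (sub_pos.2 hlt))).eventually_gt_atTop _))
    obtain ⟨T, hT0, hT, hTC⟩ := hev.exists
    obtain ⟨r, R, hr, hrR, hRr, x, hx, hle⟩ :=
      hμ.exists_le_measureReal_ball hn hn1 hI hsep hp hT0 hT
    have hup := hs r R hr hrR x hx
    rw [hRr, measure_ball_div_le_ofReal_iff hx hr (by positivity)] at hup
    have h1 := le_of_mul_le_mul_right (hle.trans hup) (measureReal_ball_pos hx hr)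
    rw [prod_mul_rpow _ _ (fun l => by positivity) (Real.exp_pos T), ← hc, ← hσ,
      ← Real.exp_mul, ← Real.exp_mul] at h1
    rw [mul_sub, Real.exp_sub, div_lt_div_iff₀ hc0 (Real.exp_pos _)] at hTC
    linarith
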